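/- Let $X,Y,Z$ be random variables with finite state spaces $\mathcal X,\mathcal Y,\mathcal Z$ and joint distribution $P$. **Shared information.** Let $\Delta_P$ be the set of all probability distributions $Q$ on $\mathcal X\times\mathcal Y\times\mathcal Z$ with $Q(X=x,Y=y)=P(X=x,Y=y)$ and $Q(X=x,Z=z)=P(X=x,Z=z)$ for all $x,y,z$. Put $$\widetilde{SI}(X:Y;Z)=\max_{Q\in\Delta_P}CoI_Q(X;Y;Z),\qquad CoI_Q(X;Y;Z)=MI_Q(X:Y)-MI_Q(X:Y|Z),$$ where $MI_Q$ denotes (conditional) mutual information with respect to $Q$. **Redundancy measure of Harder, Salge and Polani.** Let $C_{\mathrm{cl}}(\langle Z\rangle_X)$ be the convex hull of the conditional distributions $P(X=\cdot\,|\,Z=z)$, over all $z\in\mathcal Z$ with $P(Z=z)>0$. For $y\in\mathcal Y$ with $P(Y=y)>0$ let $$p_{y\searrow Z}\in\operatorname*{arg\,min}_{r\in C_{\mathrm{cl}}(\langle Z\rangle_X)}D\big(P(X=\cdot\,|\,Y=y)\,\big\|\,r\big),$$ where $D$ is the Kullback–Leibler divergence ($+\infty$ in the absence of absolute continuity), and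 let $$I^\pi_X(Y\searrow Z)=\sum_{x,y}P(X=x,Y=y)\log\frac{p_{y\searrow Z}(x)}{P(X=x)},$$ the sum being over all $x,y$ with $P(X=x,Y=y)>0$. (A minimizer exists, and the value does not depend on which one is chosen.) Define $I^\pi_X(Z\searrow Y)$ in the same way with $Y$ and $Z$ exchanged, and put $$I_{\mathrm{red}}(X:Y;Z)=\min\{I^\pi_X(Y\searrow Z),\,I^\pi_X(Z\searrow Y)\}.$$ **Theorem.** $I_{\mathrm{red}}(X:Y;Z)=0$ if and only if $\widetilde{SI}(X:Y;Z)=0$. -/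

import Mathlib

namespace InfoDecomp

noncomputable section

universe u v w

/-! ## Finite distributions, entropy, mutual information

A distribution on a finite set `α` is an element of `stdSimplex ℝ α`.  The joint distribution of
three random variables with finite state spaces `X`, `Y`, `Z` is an element of
`stdSimplex ℝ (X × Y × Z)`.  All information quantities are measured in nats. -/

/-- Marginal distribution of the first coordinate. -/
def fstMarginal {α : Type u} {β : Type v} [Fintype β] (p : α × β → ℝ) : α → ℝ :=
  fun a => ∑ b, p (a, b)

/-- Marginal distribution of the second coordinate. -/
def sndMarginal {α : Type u} {β : Type v} [Fintype α] (p : α × β → ℝ) : β → ℝ :=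
  fun b => ∑ a, p (a, b)

/-- The distribution of `(X, Y)` under a joint distribution of `(X, Y, Z)`. -/
def margXY {X : Type u} {Y : Type v} {Z : Type w} [Fintype Z] (P : X × Y × Z → ℝ) :
    X × Y → ℝ :=
  fun s => ∑ z, P (s.1, s.2, z)

/-- The distribution of `(X, Z)` under a joint distribution of `(X, Y, Z)`. -/
def margXZ {X : Type u} {Y : Type v} {Z : Type w} [Fintype Y] (P : X × Y × Z → ℝ) :
    X × Z → ℝ :=
  fun s => ∑ y, P (s.1, y, s.2)

/-- The distribution of `(Y, Z)` under a joint distribution of `(X, Y, Z)`. -/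
def margYZ {X : Type u} {Y : Type v} {Z : Type w} [Fintype X] (P : X × Y × Z → ℝ) :
    Y × Z → ℝ :=
  fun s => ∑ x, P (x, s.1, s.2)

/-- Shannon entropy `H(p) = - ∑ a, p a * log (p a)`. -/
def entropy {α : Type u} [Fintype α] (p : α → ℝ) : ℝ :=
  ∑ a, Real.negMulLog (p a)

/-- Mutual information `MI(A:B) = H(A) + H(B) - H(A,B)` of the two coordinates. -/
def mutualInfo {α : Type u} {β : Type v} [Fintype α] [Fintype β] (p : α × β → ℝ) : ℝ :=
  entropy (fstMarginal p) + entropy (sndMarginal p) - entropy p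

/-- Conditional mutual information
`MI_Q(X:Y|Z) = H_Q(X,Z) + H_Q(Y,Z) - H_Q(X,Y,Z) - H_Q(Z)`. -/
def condMutualInfo {X : Type u} {Y : Type v} {Z : Type w} [Fintype X] [Fintype Y] [Fintype Z]
    (Q : X × Y × Z → ℝ) : ℝ :=
  entropy (margXZ Q) + entropy (margYZ Q) - entropy Q - entropy (sndMarginal (margXZ Q))

/-- Co-information `CoI_Q(X;Y;Z) = MI_Q(X:Y) - MI_Q(X:Y|Z)`. -/
def coInfo {X : Type u} {Y : Type v} {Z : Type w} [Fintype X] [Fintype Y] [Fintype Z]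
    (Q : X × Y × Z → ℝ) : ℝ :=
  mutualInfo (margXY Q) - condMutualInfo Q

/-! ## The shared information `S̃I` -/

/-- `Δ_P`: all joint distributions with the same `(X,Y)`- and `(X,Z)`-marginals as `P`. -/
def DeltaP {X : Type u} {Y : Type v} {Z : Type w} [Fintype X] [Fintype Y] [Fintype Z]
    (P : X × Y × Z → ℝ) : Set (X × Y × Z → ℝ) :=
  {Q | Q ∈ stdSimplex ℝ (X × Y × Z) ∧ margXY Q = margXY P ∧ margXZ Q = margXZ P}

/-- `S̃I(X:Y;Z) = max_{Q ∈ Δ_P} CoI_Q(X;Y;Z)`.  The maximum is attained, see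
`isGreatest_sharedInfo`. -/
def sharedInfo {X : Type u} {Y : Type v} {Z : Type w} [Fintype X] [Fintype Y] [Fintype Z]
    (P : X × Y × Z → ℝ) : ℝ :=
  sSup (coInfo '' DeltaP P)

/-! ## The redundancy measure `I_red` of Harder, Salge and Polani -/

/-- Relative entropy (Kullback–Leibler divergence)
`D(p ‖ q) = ∑ a, p a * log (p a / q a)` on a finite set, equal to `+∞` unless `p` is absolutely
continuous with respect to `q`. -/
def relEntropy {α : Type u} [Fintype α] (p q : α → ℝ) : EReal :=
  open Classical in
  if ∀ a, q a = 0 → p a = 0 then ((∑ a, p a * Real.log (p a / q a) : ℝ) : EReal) else ⊤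

/-- `r` is an information projection of `p` onto `C`: a minimizer of `D(p ‖ ·)` over `C`. -/
def IsInfoProjection {α : Type u} [Fintype α] (p : α → ℝ) (C : Set (α → ℝ)) (r : α → ℝ) : Prop :=
  r ∈ C ∧ ∀ q ∈ C, relEntropy p r ≤ relEntropy p q

/-- A choice of `argmin_{r ∈ C} D(p ‖ r)`.  For the sets used below a minimizer exists
(`isInfoProjection_infoProj`) and the choice does not matter (`projectedInfo_eq`). -/
def infoProj {α : Type u} [Fintype α] (p : α → ℝ) (C : Set (α → ℝ)) : α → ℝ :=
  Classical.epsilon (IsInfoProjection p C)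

/-- The conditional distribution `p(· | y)` of the first coordinate (meaningful if `p(y) > 0`). -/
def condDist {X : Type u} {Y : Type v} [Fintype X] (p : X × Y → ℝ) (y : Y) : X → ℝ :=
  fun x => p (x, y) / sndMarginal p y

/-- `C_cl(⟨Z⟩_X)`: the convex closure of the conditional distributions `q(· | z)` of `X`, where `z`
ranges over the values of positive probability.  (The convex hull of a finite set is closed.) -/
def condHull {X : Type u} {Z : Type w} [Fintype X] (q : X × Z → ℝ) : Set (X → ℝ) :=
  convexHull ℝ {r | ∃ z, 0 < sndMarginal q z ∧ r = condDist q z}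

/-- Projected information
`I^π_X(Y ↘ Z) = ∑_{x,y} p(x,y) log (p_{y ↘ Z}(x) / p(x))`, where `p_{y ↘ Z}` is the information
projection of `p(· | y)` onto `C_cl(⟨Z⟩_X)`.  Here `p` is the distribution of `(X,Y)` and `q` is the
distribution of `(X,Z)`; values `y` of probability zero contribute `0`. -/
def projectedInfo {X : Type u} {Y : Type v} {Z : Type w} [Fintype X] [Fintype Y]
    (p : X × Y → ℝ) (q : X × Z → ℝ) : ℝ :=
  ∑ y, ∑ x, p (x, y) * Real.log (infoProj (condDist p y) (condHull q) x / fstMarginal p x)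

/-- `I_red(X:Y;Z) = min {I^π_X(Y ↘ Z), I^π_X(Z ↘ Y)}`. -/
def redInfo {X : Type u} {Y : Type v} {Z : Type w} [Fintype X] [Fintype Y] [Fintype Z]
    (P : X × Y × Z → ℝ) : ℝ :=
  min (projectedInfo (margXY P) (margXZ P)) (projectedInfo (margXZ P) (margXY P))

/-! ## The extrema in the definitions are attained -/

theorem continuous_entropy {α : Type u} [Fintype α] :
    Continuous (entropy : (α → ℝ) → ℝ) := by
  unfold entropy
  exact continuous_finsetSum _ fun a _ => Real.continuous_negMulLog.comp (continuous_apply a)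

theorem continuous_coInfo {X : Type u} {Y : Type v} {Z : Type w} [Fintype X] [Fintype Y]
    [Fintype Z] : Continuous (coInfo : (X × Y × Z → ℝ) → ℝ) := by
  have hXY : Continuous (margXY : (X × Y × Z → ℝ) → _) := by unfold margXY; fun_prop
  have hXZ : Continuous (margXZ : (X × Y × Z → ℝ) → _) := by unfold margXZ; fun_prop
  have hYZ : Continuous (margYZ : (X × Y × Z → ℝ) → _) := by unfold margYZ; fun_prop
  have h1 : Continuous (fstMarginal : (X × Y → ℝ) → _) := by unfold fstMarginal; fun_prop
  have h2 : Continuous (sndMarginal : (X × Y → ℝ) → _) := by unfold sndMarginal; fun_prop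
  have h3 : Continuous (sndMarginal : (X × Z → ℝ) → _) := by unfold sndMarginal; fun_prop
  unfold coInfo mutualInfo condMutualInfo
  exact (((continuous_entropy.comp (h1.comp hXY)).add (continuous_entropy.comp (h2.comp hXY))).sub
    (continuous_entropy.comp hXY)).sub ((((continuous_entropy.comp hXZ).add
    (continuous_entropy.comp hYZ)).sub continuous_entropy).sub
    (continuous_entropy.comp (h3.comp hXZ)))

theorem isCompact_DeltaP {X : Type u} {Y : Type v} {Z : Type w} [Fintype X] [Fintype Y]
    [Fintype Z] (P : X × Y × Z → ℝ) : IsCompact (DeltaP P) := by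
  have hXY : Continuous (margXY : (X × Y × Z → ℝ) → _) := by unfold margXY; fun_prop
  have hXZ : Continuous (margXZ : (X × Y × Z → ℝ) → _) := by unfold margXZ; fun_prop
  exact (isCompact_stdSimplex ℝ (X × Y × Z)).inter_right
    ((isClosed_eq hXY continuous_const).inter (isClosed_eq hXZ continuous_const))

/-- `S̃I` is the maximum of the co-information over `Δ_P`. -/
theorem isGreatest_sharedInfo {X : Type u} {Y : Type v} {Z : Type w} [Fintype X] [Fintype Y]
    [Fintype Z] {P : X × Y × Z → ℝ} (hP : P ∈ stdSimplex ℝ (X × Y × Z)) :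
    IsGreatest (coInfo '' DeltaP P) (sharedInfo P) :=
  ((isCompact_DeltaP P).image continuous_coInfo).isGreatest_sSup ⟨_, P, ⟨hP, rfl, rfl⟩, rfl⟩

theorem exists_isInfoProjection {α : Type u} [Fintype α] {p : α → ℝ} {C : Set (α → ℝ)}
    (hC : IsCompact C) (hne : C.Nonempty) (hC0 : ∀ q ∈ C, ∀ a, 0 ≤ q a) (hp : ∀ a, 0 ≤ p a) :
    ∃ r, IsInfoProjection p C r := by
  classical
  have hcont : Continuous fun q : α → ℝ => ∏ a, q a ^ p a :=
    continuous_finsetProd _ fun a _ =>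
      (Real.continuous_rpow_const (hp a)).comp (continuous_apply a)
  obtain ⟨r, hr, hmax⟩ := hC.exists_isMaxOn hne hcont.continuousOn
  have hpos : ∀ q ∈ C, (∀ a, q a = 0 → p a = 0) → ∀ a, 0 < q a ^ p a := by
    intro q hq h a
    rcases (hC0 q hq a).eq_or_lt with h0 | h0
    · rw [h a h0.symm, Real.rpow_zero]; exact one_pos
    · exact Real.rpow_pos_of_pos h0 _
  have hlog : ∀ q ∈ C, (∀ a, q a = 0 → p a = 0) →
      ∑ a, p a * Real.log (p a / q a) =
        ∑ a, p a * Real.log (p a) - Real.log (∏ a, q a ^ p a) := by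
    intro q hq h
    rw [Real.log_prod fun a _ => (hpos q hq h a).ne', ← Finset.sum_sub_distrib]
    refine Finset.sum_congr rfl fun a _ => ?_
    by_cases hpa : p a = 0
    · simp [hpa]
    · have hqa : q a ≠ 0 := fun h' => hpa (h a h')
      rw [Real.log_div hpa hqa, Real.log_rpow ((hC0 q hq a).lt_of_ne hqa.symm)]
      ring
  refine ⟨r, hr, fun q hq => ?_⟩
  by_cases hac : ∀ a, q a = 0 → p a = 0
  · have hqpos : 0 < ∏ a, q a ^ p a := Finset.prod_pos fun a _ => hpos q hq hac a
    have hle : ∏ a, q a ^ p a ≤ ∏ a, r a ^ p a := hmax hq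
    have hrac : ∀ a, r a = 0 → p a = 0 := by
      intro a ha
      by_contra hpa
      have : ∏ a, r a ^ p a = 0 :=
        Finset.prod_eq_zero (Finset.mem_univ a) (by rw [ha, Real.zero_rpow hpa])
      linarith
    rw [relEntropy, relEntropy, if_pos hac, if_pos hrac, EReal.coe_le_coe_iff, hlog q hq hac,
      hlog r hr hrac]
    have := Real.log_le_log hqpos hle
    linarith
  · rw [show relEntropy p q = ⊤ from if_neg hac]
    exact le_top

theorem sndMarginal_nonneg {X : Type u} {Y : Type v} [Fintype X] [Fintype Y] {p : X × Y → ℝ}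
    (hp : p ∈ stdSimplex ℝ (X × Y)) (y : Y) : 0 ≤ sndMarginal p y :=
  Finset.sum_nonneg fun x _ => hp.1 (x, y)

theorem condDist_nonneg {X : Type u} {Y : Type v} [Fintype X] [Fintype Y] {p : X × Y → ℝ}
    (hp : p ∈ stdSimplex ℝ (X × Y)) (y : Y) (x : X) : 0 ≤ condDist p y x :=
  div_nonneg (hp.1 (x, y)) (sndMarginal_nonneg hp y)

theorem condHull_nonneg {X : Type u} {Z : Type w} [Fintype X] [Fintype Z] {q : X × Z → ℝ}
    (hq : q ∈ stdSimplex ℝ (X × Z)) : ∀ r ∈ condHull q, ∀ x, 0 ≤ r x := by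
  have hsub : condHull q ⊆ Set.Ici (0 : X → ℝ) := by
    refine convexHull_min ?_ (convex_Ici 0)
    rintro r ⟨z, -, rfl⟩ x
    exact condDist_nonneg hq z x
  exact fun r hr x => hsub hr x

theorem isCompact_condHull {X : Type u} {Z : Type w} [Fintype X] [Fintype Z] (q : X × Z → ℝ) :
    IsCompact (condHull q) := by
  refine Set.Finite.isCompact_convexHull ℝ ((Set.finite_range (condDist q)).subset ?_)
  rintro r ⟨z, -, rfl⟩
  exact ⟨z, rfl⟩

theorem condHull_nonempty {X : Type u} {Z : Type w} [Fintype X] [Fintype Z] {q : X × Z → ℝ}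
    (hq : q ∈ stdSimplex ℝ (X × Z)) : (condHull q).Nonempty := by
  by_contra hcon
  have hz : ∀ z, sndMarginal q z = 0 := fun z => by
    rcases (sndMarginal_nonneg hq z).eq_or_lt with h | h
    · exact h.symm
    · exact absurd ⟨_, subset_convexHull ℝ _ ⟨z, h, rfl⟩⟩ hcon
  have h1 := hq.2
  rw [Fintype.sum_prod_type_right] at h1
  have : ∑ z, sndMarginal q z = 1 := h1
  simp [hz] at this

/-- The information projection used in `projectedInfo` exists. -/
theorem isInfoProjection_infoProj {X : Type u} {Y : Type v} {Z : Type w} [Fintype X] [Fintype Y]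
    [Fintype Z] {p : X × Y → ℝ} {q : X × Z → ℝ} (hp : p ∈ stdSimplex ℝ (X × Y))
    (hq : q ∈ stdSimplex ℝ (X × Z)) (y : Y) :
    IsInfoProjection (condDist p y) (condHull q) (infoProj (condDist p y) (condHull q)) :=
  Classical.epsilon_spec (exists_isInfoProjection (isCompact_condHull q) (condHull_nonempty hq)
    (condHull_nonneg hq) (condDist_nonneg hp y))

theorem margXY_mem {X : Type u} {Y : Type v} {Z : Type w} [Fintype X] [Fintype Y] [Fintype Z]
    {P : X × Y × Z → ℝ} (hP : P ∈ stdSimplex ℝ (X × Y × Z)) :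
    margXY P ∈ stdSimplex ℝ (X × Y) := by
  refine ⟨fun s => Finset.sum_nonneg fun z _ => hP.1 _, ?_⟩
  rw [← hP.2]
  simp [margXY, Fintype.sum_prod_type]

theorem margXZ_mem {X : Type u} {Y : Type v} {Z : Type w} [Fintype X] [Fintype Y] [Fintype Z]
    {P : X × Y × Z → ℝ} (hP : P ∈ stdSimplex ℝ (X × Y × Z)) :
    margXZ P ∈ stdSimplex ℝ (X × Z) := by
  refine ⟨fun s => Finset.sum_nonneg fun y _ => hP.1 _, ?_⟩
  rw [← hP.2]
  simp only [margXZ, Fintype.sum_prod_type]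
  exact Finset.sum_congr rfl fun x _ => Finset.sum_comm

/-- If `D(p ‖ r) < ∞` is the same for `r` and `r'`, then `r` and `r'` give the same expected
logarithm of the ratio to any `m` with `p ≪ m`. -/
theorem sum_log_div_congr {α : Type u} [Fintype α] {p r r' m : α → ℝ}
    (hm : ∀ a, m a = 0 → p a = 0) (hr : relEntropy p r ≠ ⊤)
    (h : relEntropy p r = relEntropy p r') :
    ∑ a, p a * Real.log (r a / m a) = ∑ a, p a * Real.log (r' a / m a) := by
  have key : ∀ s : α → ℝ, relEntropy p s ≠ ⊤ → relEntropy p s =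
      ((∑ a, p a * Real.log (p a / m a) - ∑ a, p a * Real.log (s a / m a) : ℝ) : EReal) := by
    intro s hs
    have hac : ∀ a, s a = 0 → p a = 0 := by
      by_contra hac
      exact hs (if_neg hac)
    rw [relEntropy, if_pos hac, ← Finset.sum_sub_distrib]
    congr 1
    refine Finset.sum_congr rfl fun a _ => ?_
    by_cases hpa : p a = 0
    · simp [hpa]
    · have hsa : s a ≠ 0 := fun h' => hpa (hac a h')
      have hma : m a ≠ 0 := fun h' => hpa (hm a h')
      rw [Real.log_div hpa hsa, Real.log_div hpa hma, Real.log_div hsa hma]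
      ring
  have h2 := h
  rw [key r hr, key r' (h ▸ hr), EReal.coe_eq_coe_iff] at h2
  linarith

/-- The marginal of `X` is a mixture of the conditional distributions of `X` given `Z`. -/
theorem fstMarginal_mem_condHull {X : Type u} {Z : Type w} [Fintype X] [Fintype Z]
    {q : X × Z → ℝ} (hq : q ∈ stdSimplex ℝ (X × Z)) : fstMarginal q ∈ condHull q := by
  classical
  have hz0 : ∀ z, sndMarginal q z = 0 → ∀ x, q (x, z) = 0 := fun z hz x =>
    (Finset.sum_eq_zero_iff_of_nonneg fun x _ => hq.1 (x, z)).1 hz x (Finset.mem_univ x)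
  have hsum : ∑ z ∈ Finset.univ.filter (fun z => 0 < sndMarginal q z), sndMarginal q z = 1 := by
    rw [Finset.sum_filter_of_ne fun z _ h => (sndMarginal_nonneg hq z).lt_of_ne h.symm]
    have h1 := hq.2
    rw [Fintype.sum_prod_type_right] at h1
    exact h1
  have hmem := (convex_convexHull ℝ {r | ∃ z, 0 < sndMarginal q z ∧ r = condDist q z}).sum_mem
    (t := Finset.univ.filter fun z => 0 < sndMarginal q z) (w := sndMarginal q)
    (z := condDist q) (fun z _ => sndMarginal_nonneg hq z) hsum
    (fun z hz => subset_convexHull ℝ _ ⟨z, (Finset.mem_filter.1 hz).2, rfl⟩)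
  refine Set.mem_of_eq_of_mem ?_ hmem
  rw [Finset.sum_filter_of_ne]
  · funext x
    simp only [Finset.sum_apply, Pi.smul_apply, smul_eq_mul, condDist, fstMarginal]
    refine Finset.sum_congr rfl fun z _ => ?_
    by_cases h : sndMarginal q z = 0
    · simp [h, hz0 z h x]
    · field_simp
  · intro z _ h
    refine (sndMarginal_nonneg hq z).lt_of_ne fun h' => h ?_
    rw [← h', zero_smul]

/-- The projected information does not depend on which information projections are chosen. -/
theorem projectedInfo_eq {X : Type u} {Y : Type v} {Z : Type w} [Fintype X] [Fintype Y]
    [Fintype Z] {p : X × Y → ℝ} {q : X × Z → ℝ} (hp : p ∈ stdSimplex ℝ (X × Y))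
    (hq : q ∈ stdSimplex ℝ (X × Z)) (hpq : fstMarginal p = fstMarginal q) (r : Y → X → ℝ)
    (hr : ∀ y, 0 < sndMarginal p y → IsInfoProjection (condDist p y) (condHull q) (r y)) :
    projectedInfo p q = ∑ y, ∑ x, p (x, y) * Real.log (r y x / fstMarginal p x) := by
  refine Finset.sum_congr rfl fun y _ => ?_
  rcases (sndMarginal_nonneg hp y).eq_or_lt with hy | hy
  · have h0 : ∀ x, p (x, y) = 0 := fun x =>
      (Finset.sum_eq_zero_iff_of_nonneg fun x _ => hp.1 (x, y)).1 hy.symm x (Finset.mem_univ x)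
    simp [h0]
  · have hm : ∀ x, fstMarginal p x = 0 → condDist p y x = 0 := fun x hx => by
      have : p (x, y) = 0 :=
        (Finset.sum_eq_zero_iff_of_nonneg fun y _ => hp.1 (x, y)).1 hx y (Finset.mem_univ y)
      simp [condDist, this]
    have hi := isInfoProjection_infoProj hp hq y
    have hfin : relEntropy (condDist p y) (fstMarginal p) ≠ ⊤ := by
      rw [relEntropy, if_pos hm]
      exact EReal.coe_ne_top _
    have hmem : fstMarginal p ∈ condHull q := hpq ▸ fstMarginal_mem_condHull hq
    have hlt : relEntropy (condDist p y) (infoProj (condDist p y) (condHull q)) ≠ ⊤ :=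
      ((hi.2 _ hmem).trans_lt (lt_top_iff_ne_top.2 hfin)).ne
    have hkey := sum_log_div_congr hm hlt
      (le_antisymm (hi.2 _ (hr y hy).1) ((hr y hy).2 _ hi.1))
    have hscale : ∀ s : X → ℝ, ∑ x, p (x, y) * Real.log (s x / fstMarginal p x) =
        sndMarginal p y * ∑ x, condDist p y x * Real.log (s x / fstMarginal p x) := by
      intro s
      rw [Finset.mul_sum]
      refine Finset.sum_congr rfl fun x _ => ?_
      rw [← mul_assoc, condDist, mul_div_cancel₀ _ hy.ne']
    rw [hscale, hscale, hkey]

end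

end InfoDecomp

/-!
Write `p`, `q` for the distributions of `(X, Y)` and `(X, Z)`, and `m` for that of `X`.  Both
quantities vanish exactly when the coupling `Q₀(x,y,z) = p(x,y) q(x,z) / m(x)`, under which `Y` and
`Z` are conditionally independent given `X`, makes `Y` and `Z` independent, that is, when
`∑ x, p(x,y) q(x,z) / m(x) = p(y) q(z)` for all `y` and `z` (`Decoupled`).

*Shared information* (`sharedInfo_eq_zero_iff`).  `Q₀` lies in `Δ_P` and its co-information is
`MI_{Q₀}(Y:Z) ≥ 0`.  Hence `S̃I = 0` forces `MI_{Q₀}(Y:Z) = 0`, and the equality case of Gibbs'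
inequality gives independence.  Conversely, the co-information of `Q ∈ Δ_P` is the expectation of
`log (Q(x,y) Q(x,z) Q(y,z) / (Q(x) Q(y) Q(z) Q(x,y,z)))`.  Under `Decoupled` the numerator divided by
`Q(x) Q(y) Q(z)` has total mass at most one, so `log t ≤ t - 1` bounds every co-information by
zero (`coInfo_nonpos`), and `Q₀` attains zero.

*Projected information* (`projectedInfo_eq_zero_iff`).  Since `m` lies in the convex hull, every
summand over `y` is nonnegative.  It vanishes only if `m` itself minimizes
`D(p(· | y) ‖ ·)`; the first-order condition at `m` in the direction of `q(· | z)` is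
`∑ x, p(x,y) q(x,z) / m(x) ≤ p(y) q(z)`, and as both sides have the same sum over `z`, equality
holds.  Conversely, under `Decoupled` the linear form `s ↦ ∑ x, p(x,y) s(x) / m(x)` is constant
equal to `p(y)` on the convex hull, and `log t ≤ t - 1` gives the upper bound zero.

`Decoupled` is symmetric in `Y` and `Z`, so the two projected informations vanish together.
-/

namespace InfoDecomp

universe u v w

variable {X : Type u} {Y : Type v} {Z : Type w}

/-! ### Gibbs' inequality, termwise -/

theorem sub_le_mul_log_sub_log {a b : ℝ} (ha : 0 ≤ a) (hb : 0 ≤ b) (h : b = 0 → a = 0) :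
    a - b ≤ a * (Real.log a - Real.log b) := by
  rcases ha.eq_or_lt with rfl | ha
  · simpa using hb
  have hb' : 0 < b := hb.lt_of_ne fun h0 => ha.ne' (h h0.symm)
  have h1 := Real.log_le_sub_one_of_pos (div_pos hb' ha)
  rw [Real.log_div hb'.ne' ha.ne'] at h1
  have h2 := mul_le_mul_of_nonneg_left h1 ha.le
  have h3 : a * (b / a - 1) = b - a := by field_simp
  linarith

theorem eq_of_sub_eq_mul_log_sub_log {a b : ℝ} (ha : 0 ≤ a) (hb : 0 ≤ b) (h : b = 0 → a = 0)
    (hab : a - b = a * (Real.log a - Real.log b)) : a = b := by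
  rcases ha.eq_or_lt with rfl | ha
  · linarith
  have hb' : 0 < b := hb.lt_of_ne fun h0 => ha.ne' (h h0.symm)
  by_contra hne
  have hne' : b / a ≠ 1 := fun h1 => hne ((div_eq_one_iff_eq ha.ne').1 h1).symm
  have h1 := Real.log_lt_sub_one_of_pos (div_pos hb' ha) hne'
  rw [Real.log_div hb'.ne' ha.ne'] at h1
  have h2 := mul_lt_mul_of_pos_left h1 ha
  have h3 : a * (b / a - 1) = b - a := by field_simp
  linarith

/-! ### Supports of marginals -/

theorem le_fstMarginal [Fintype Y] {p : X × Y → ℝ} (hp : ∀ s, 0 ≤ p s) (x : X) (y : Y) :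
    p (x, y) ≤ fstMarginal p x :=
  Finset.single_le_sum (f := fun y => p (x, y)) (fun _ _ => hp _) (Finset.mem_univ y)

theorem le_sndMarginal [Fintype X] {p : X × Y → ℝ} (hp : ∀ s, 0 ≤ p s) (x : X) (y : Y) :
    p (x, y) ≤ sndMarginal p y :=
  Finset.single_le_sum (f := fun x => p (x, y)) (fun _ _ => hp _) (Finset.mem_univ x)

theorem fstMarginal_nonneg [Fintype Y] {p : X × Y → ℝ} (hp : ∀ s, 0 ≤ p s) (x : X) :
    0 ≤ fstMarginal p x :=
  Finset.sum_nonneg fun y _ => hp (x, y)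

theorem eq_zero_of_fstMarginal_eq_zero [Fintype Y] {p : X × Y → ℝ} (hp : ∀ s, 0 ≤ p s)
    {x : X} (hx : fstMarginal p x = 0) (y : Y) : p (x, y) = 0 :=
  le_antisymm (hx ▸ le_fstMarginal hp x y) (hp _)

theorem eq_zero_of_sndMarginal_eq_zero [Fintype X] {p : X × Y → ℝ} (hp : ∀ s, 0 ≤ p s)
    {y : Y} (hy : sndMarginal p y = 0) (x : X) : p (x, y) = 0 :=
  le_antisymm (hy ▸ le_sndMarginal hp x y) (hp _)

theorem sum_sndMarginal [Fintype X] [Fintype Y] {p : X × Y → ℝ} (hp : p ∈ stdSimplex ℝ (X × Y)) :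
    ∑ y, sndMarginal p y = 1 := by
  rw [← hp.2, Fintype.sum_prod_type_right]
  rfl

theorem fstMarginal_margXY_eq [Fintype Y] [Fintype Z] (P : X × Y × Z → ℝ) :
    fstMarginal (margXY P) = fstMarginal (margXZ P) :=
  funext fun _ => Finset.sum_comm

/-! ### The conditionally independent coupling -/

/-- The joint distribution of `(X, Y, Z)` under which `(X, Y)` has distribution `p`, `(X, Z)` has
distribution `q`, and `Y` and `Z` are independent given `X`.  Values `x` of probability zero get
mass zero through division by zero. -/
noncomputable def condIndepCoupling [Fintype Y] (p : X × Y → ℝ) (q : X × Z → ℝ) :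
    X × Y × Z → ℝ :=
  fun s => p (s.1, s.2.1) * q (s.1, s.2.2) / fstMarginal p s.1

theorem condIndepCoupling_nonneg [Fintype Y] {p : X × Y → ℝ} {q : X × Z → ℝ} (hp : ∀ s, 0 ≤ p s)
    (hq : ∀ s, 0 ≤ q s) (s : X × Y × Z) : 0 ≤ condIndepCoupling p q s :=
  div_nonneg (mul_nonneg (hp _) (hq _)) (fstMarginal_nonneg hp _)

theorem margXY_condIndepCoupling [Fintype Y] [Fintype Z] {p : X × Y → ℝ} {q : X × Z → ℝ}
    (hp : ∀ s, 0 ≤ p s)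
    (hpq : fstMarginal p = fstMarginal q) : margXY (condIndepCoupling p q) = p := by
  funext ⟨x, y⟩
  have h : ∑ z, q (x, z) = fstMarginal p x := by rw [hpq]; rfl
  simp only [margXY, condIndepCoupling]
  rw [← Finset.sum_div, ← Finset.mul_sum, h]
  by_cases hx : fstMarginal p x = 0
  · simp [eq_zero_of_fstMarginal_eq_zero hp hx y]
  · exact mul_div_cancel_right₀ _ hx

theorem margXZ_condIndepCoupling [Fintype Y] [Fintype Z] {p : X × Y → ℝ} {q : X × Z → ℝ}
    (hq : ∀ s, 0 ≤ q s) (hpq : fstMarginal p = fstMarginal q) :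
    margXZ (condIndepCoupling p q) = q := by
  funext ⟨x, z⟩
  have h : ∑ y, p (x, y) = fstMarginal p x := rfl
  simp only [margXZ, condIndepCoupling]
  rw [← Finset.sum_div, ← Finset.sum_mul, h]
  by_cases hx : fstMarginal p x = 0
  · simp [eq_zero_of_fstMarginal_eq_zero hq (hpq ▸ hx) z]
  · exact mul_div_cancel_left₀ _ hx

variable [Fintype X] [Fintype Y] [Fintype Z]

/-- `Y` and `Z` are independent under the coupling of `p` and `q` that makes them conditionally
independent given `X`. -/
def Decoupled (p : X × Y → ℝ) (q : X × Z → ℝ) : Prop :=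
  ∀ y z, ∑ x, p (x, y) * q (x, z) / fstMarginal p x = sndMarginal p y * sndMarginal q z

theorem Decoupled.symm {p : X × Y → ℝ} {q : X × Z → ℝ} (hpq : fstMarginal p = fstMarginal q)
    (h : Decoupled p q) : Decoupled q p := by
  intro z y
  rw [mul_comm, ← h y z, hpq]
  exact Finset.sum_congr rfl fun x _ => by rw [mul_comm]

theorem condIndepCoupling_mem_stdSimplex {p : X × Y → ℝ} {q : X × Z → ℝ}
    (hp : p ∈ stdSimplex ℝ (X × Y)) (hq : ∀ s, 0 ≤ q s) (hpq : fstMarginal p = fstMarginal q) :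
    condIndepCoupling p q ∈ stdSimplex ℝ (X × Y × Z) := by
  refine ⟨condIndepCoupling_nonneg hp.1 hq, ?_⟩
  rw [← hp.2, ← margXY_condIndepCoupling (q := q) hp.1 hpq]
  simp only [margXY, Fintype.sum_prod_type]
  rw [margXY_condIndepCoupling hp.1 hpq]

/-! ### Co-information as an expectation -/

theorem entropy_eq_sum_mul_log {α : Type*} [Fintype α] (p : α → ℝ) :
    entropy p = -∑ a, p a * Real.log (p a) := by
  simp [entropy, Real.negMulLog]

/-- The co-information is the expectation of the logarithm of
`Q(x,y) Q(x,z) Q(y,z) / (Q(x) Q(y) Q(z) Q(x,y,z))`. -/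
theorem coInfo_eq_sum (Q : X × Y × Z → ℝ) :
    coInfo Q = ∑ y, ∑ z, ∑ x, Q (x, y, z) *
      (Real.log (margXY Q (x, y)) + Real.log (margXZ Q (x, z)) + Real.log (margYZ Q (y, z))
        - Real.log (fstMarginal (margXY Q) x) - Real.log (sndMarginal (margXY Q) y)
        - Real.log (sndMarginal (margXZ Q) z) - Real.log (Q (x, y, z))) := by
  have hcomm : ∀ f : X → Y → Z → ℝ, ∑ y, ∑ z, ∑ x, f x y z = ∑ x, ∑ y, ∑ z, f x y z := by
    intro f
    calc _ = ∑ y, ∑ x, ∑ z, f x y z := Finset.sum_congr rfl fun y _ => Finset.sum_comm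
      _ = _ := Finset.sum_comm
  have hXYZ : entropy Q = -∑ x, ∑ y, ∑ z, Q (x, y, z) * Real.log (Q (x, y, z)) := by
    rw [entropy_eq_sum_mul_log]; simp only [Fintype.sum_prod_type]
  have hXY : entropy (margXY Q) =
      -∑ x, ∑ y, ∑ z, Q (x, y, z) * Real.log (margXY Q (x, y)) := by
    rw [entropy_eq_sum_mul_log]
    simp only [Fintype.sum_prod_type, ← Finset.sum_mul]
    rfl
  have hXZ : entropy (margXZ Q) =
      -∑ x, ∑ y, ∑ z, Q (x, y, z) * Real.log (margXZ Q (x, z)) := by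
    rw [entropy_eq_sum_mul_log]
    simp only [Fintype.sum_prod_type]
    congr 1
    refine Finset.sum_congr rfl fun x _ => ?_
    rw [Finset.sum_comm]
    simp only [← Finset.sum_mul]
    rfl
  have hYZ : entropy (margYZ Q) =
      -∑ x, ∑ y, ∑ z, Q (x, y, z) * Real.log (margYZ Q (y, z)) := by
    rw [entropy_eq_sum_mul_log, ← hcomm]
    simp only [Fintype.sum_prod_type, ← Finset.sum_mul]
    rfl
  have hX : entropy (fstMarginal (margXY Q)) =
      -∑ x, ∑ y, ∑ z, Q (x, y, z) * Real.log (fstMarginal (margXY Q) x) := by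
    rw [entropy_eq_sum_mul_log]
    simp only [← Finset.sum_mul]
    rfl
  have hY : entropy (sndMarginal (margXY Q)) =
      -∑ x, ∑ y, ∑ z, Q (x, y, z) * Real.log (sndMarginal (margXY Q) y) := by
    rw [entropy_eq_sum_mul_log, Finset.sum_comm]
    simp only [← Finset.sum_mul]
    rfl
  have hZ : entropy (sndMarginal (margXZ Q)) =
      -∑ x, ∑ y, ∑ z, Q (x, y, z) * Real.log (sndMarginal (margXZ Q) z) := by
    rw [entropy_eq_sum_mul_log]
    congr 1
    calc _ = ∑ z, ∑ x, ∑ y, Q (x, y, z) * Real.log (sndMarginal (margXZ Q) z) := by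
          simp only [← Finset.sum_mul]; rfl
      _ = ∑ x, ∑ z, ∑ y, Q (x, y, z) * Real.log (sndMarginal (margXZ Q) z) := Finset.sum_comm
      _ = _ := Finset.sum_congr rfl fun x _ => Finset.sum_comm
  rw [hcomm, coInfo, mutualInfo, condMutualInfo, hXYZ, hXY, hXZ, hYZ, hX, hY, hZ]
  simp only [mul_sub, mul_add, Finset.sum_sub_distrib, Finset.sum_add_distrib]
  ring

/-! ### Shared information -/

/-- Under `Decoupled`, a condition on the `(X,Y)`- and `(X,Z)`-marginals only, the co-information
cannot be positive. -/
theorem coInfo_nonpos {Q : X × Y × Z → ℝ} (hQ : Q ∈ stdSimplex ℝ (X × Y × Z))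
    (h : Decoupled (margXY Q) (margXZ Q)) : coInfo Q ≤ 0 := by
  have hXY := margXY_mem hQ
  have hXZ := margXZ_mem hQ
  have hYZ0 : ∀ s, 0 ≤ margYZ Q s := fun s => Finset.sum_nonneg fun x _ => hQ.1 _
  -- the comparison mass `Q(x,y) Q(x,z) / Q(x) * Q(y,z) / (Q(y) Q(z))` used in `log t ≤ t - 1`
  let B : X → Y → Z → ℝ := fun x y z =>
    margXY Q (x, y) * margXZ Q (x, z) / fstMarginal (margXY Q) x *
      (margYZ Q (y, z) / (sndMarginal (margXY Q) y * sndMarginal (margXZ Q) z))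
  have hB0 : ∀ x y z, 0 ≤ B x y z := fun x y z =>
    mul_nonneg (div_nonneg (mul_nonneg (hXY.1 _) (hXZ.1 _)) (fstMarginal_nonneg hXY.1 x))
      (div_nonneg (hYZ0 _) (mul_nonneg (sndMarginal_nonneg hXY y) (sndMarginal_nonneg hXZ z)))
  have hterm : ∀ x y z, Q (x, y, z) *
      (Real.log (margXY Q (x, y)) + Real.log (margXZ Q (x, z)) + Real.log (margYZ Q (y, z))
        - Real.log (fstMarginal (margXY Q) x) - Real.log (sndMarginal (margXY Q) y)
        - Real.log (sndMarginal (margXZ Q) z) - Real.log (Q (x, y, z)))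
      ≤ B x y z - Q (x, y, z) := by
    intro x y z
    rcases (hQ.1 (x, y, z)).eq_or_lt with h0 | h0
    · rw [← h0]; simpa using hB0 x y z
    have a1 : 0 < margXY Q (x, y) := h0.trans_le <|
      Finset.single_le_sum (f := fun z => Q (x, y, z)) (fun _ _ => hQ.1 _) (Finset.mem_univ z)
    have a2 : 0 < margXZ Q (x, z) := h0.trans_le <|
      Finset.single_le_sum (f := fun y => Q (x, y, z)) (fun _ _ => hQ.1 _) (Finset.mem_univ y)
    have a3 : 0 < margYZ Q (y, z) := h0.trans_le <|
      Finset.single_le_sum (f := fun x => Q (x, y, z)) (fun _ _ => hQ.1 _) (Finset.mem_univ x)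
    have a4 := a1.trans_le (le_fstMarginal hXY.1 x y)
    have a5 := a1.trans_le (le_sndMarginal hXY.1 x y)
    have a6 := a2.trans_le (le_sndMarginal hXZ.1 x z)
    have hBpos : 0 < B x y z := by positivity
    have hlog : Real.log (B x y z) =
        Real.log (margXY Q (x, y)) + Real.log (margXZ Q (x, z)) + Real.log (margYZ Q (y, z))
        - Real.log (fstMarginal (margXY Q) x) - Real.log (sndMarginal (margXY Q) y)
        - Real.log (sndMarginal (margXZ Q) z) := by
      simp only [B]
      rw [Real.log_mul (by positivity) (by positivity), Real.log_div (by positivity) a4.ne',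
        Real.log_div a3.ne' (by positivity), Real.log_mul a1.ne' a2.ne',
        Real.log_mul a5.ne' a6.ne']
      ring
    rw [← hlog]
    have := sub_le_mul_log_sub_log h0.le hBpos.le fun h => absurd h hBpos.ne'
    linarith
  have hBsum : ∀ y z, ∑ x, B x y z ≤ margYZ Q (y, z) := by
    intro y z
    simp only [B]
    rw [← Finset.sum_mul, h y z]
    -- if `Q(y) Q(z) = 0`, the left-hand side is zero
    by_cases h0 : sndMarginal (margXY Q) y * sndMarginal (margXZ Q) z = 0
    · rw [h0, zero_mul]; exact hYZ0 _
    · rw [mul_div_cancel₀ _ h0]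
  rw [coInfo_eq_sum]
  refine Finset.sum_nonpos fun y _ => Finset.sum_nonpos fun z _ => ?_
  refine (Finset.sum_le_sum fun x _ => hterm x y z).trans ?_
  rw [Finset.sum_sub_distrib]
  exact sub_nonpos.2 (hBsum y z)

/-- For the conditionally independent coupling, the co-information is `MI(Y:Z)`. -/
theorem coInfo_condIndepCoupling {p : X × Y → ℝ} {q : X × Z → ℝ} (hp : ∀ s, 0 ≤ p s)
    (hq : ∀ s, 0 ≤ q s) (hpq : fstMarginal p = fstMarginal q) :
    coInfo (condIndepCoupling p q) = ∑ y, ∑ z, margYZ (condIndepCoupling p q) (y, z) *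
      (Real.log (margYZ (condIndepCoupling p q) (y, z))
        - Real.log (sndMarginal p y * sndMarginal q z)) := by
  rw [coInfo_eq_sum, margXY_condIndepCoupling hp hpq, margXZ_condIndepCoupling hq hpq]
  refine Finset.sum_congr rfl fun y _ => Finset.sum_congr rfl fun z _ => ?_
  rw [show margYZ (condIndepCoupling p q) (y, z) = ∑ x, condIndepCoupling p q (x, y, z) from rfl,
    Finset.sum_mul]
  refine Finset.sum_congr rfl fun x _ => ?_
  rcases (condIndepCoupling_nonneg hp hq (x, y, z)).eq_or_lt with h0 | h0
  · simp [← h0]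
  have hne : p (x, y) * q (x, z) / fstMarginal p x ≠ 0 := h0.ne'
  have a1 : p (x, y) ≠ 0 := fun h => hne (by simp [h])
  have a2 : q (x, z) ≠ 0 := fun h => hne (by simp [h])
  have a3 : fstMarginal p x ≠ 0 := fun h => hne (by simp [h])
  have a4 : sndMarginal p y ≠ 0 := fun h => a1 (eq_zero_of_sndMarginal_eq_zero hp h x)
  have a5 : sndMarginal q z ≠ 0 := fun h => a2 (eq_zero_of_sndMarginal_eq_zero hq h x)
  rw [Real.log_mul a4 a5, show Real.log (condIndepCoupling p q (x, y, z)) =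
    Real.log (p (x, y)) + Real.log (q (x, z)) - Real.log (fstMarginal p x) by
      rw [condIndepCoupling, Real.log_div (mul_ne_zero a1 a2) a3, Real.log_mul a1 a2]]
  ring

/-- `MI(Y:Z) ≤ 0` forces independence of `Y` and `Z`, by the equality case of Gibbs' inequality. -/
theorem decoupled_of_coInfo_condIndepCoupling_nonpos {p : X × Y → ℝ} {q : X × Z → ℝ}
    (hp : p ∈ stdSimplex ℝ (X × Y)) (hq : q ∈ stdSimplex ℝ (X × Z))
    (hpq : fstMarginal p = fstMarginal q) (h : coInfo (condIndepCoupling p q) ≤ 0) :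
    Decoupled p q := by
  rw [coInfo_condIndepCoupling hp.1 hq.1 hpq, ← Fintype.sum_prod_type'
    (f := fun y z => margYZ (condIndepCoupling p q) (y, z) *
      (Real.log (margYZ (condIndepCoupling p q) (y, z))
        - Real.log (sndMarginal p y * sndMarginal q z)))] at h
  have ha : ∀ s, 0 ≤ margYZ (condIndepCoupling p q) s := fun s =>
    Finset.sum_nonneg fun x _ => condIndepCoupling_nonneg hp.1 hq.1 _
  have hb : ∀ s : Y × Z, 0 ≤ sndMarginal p s.1 * sndMarginal q s.2 := fun s =>
    mul_nonneg (sndMarginal_nonneg hp _) (sndMarginal_nonneg hq _)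
  have hac : ∀ s : Y × Z, sndMarginal p s.1 * sndMarginal q s.2 = 0 →
      margYZ (condIndepCoupling p q) s = 0 := by
    rintro ⟨y, z⟩ h0
    refine Finset.sum_eq_zero fun x _ => ?_
    rcases mul_eq_zero.1 h0 with h0 | h0
    · simp [condIndepCoupling, eq_zero_of_sndMarginal_eq_zero hp.1 h0 x]
    · simp [condIndepCoupling, eq_zero_of_sndMarginal_eq_zero hq.1 h0 x]
  have hle := fun s : Y × Z => sub_le_mul_log_sub_log (ha s) (hb s) (hac s)
  have hsum : ∑ s : Y × Z, (margYZ (condIndepCoupling p q) s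
      - sndMarginal p s.1 * sndMarginal q s.2) = 0 := by
    rw [Finset.sum_sub_distrib, Fintype.sum_prod_type
      (f := fun s : Y × Z => sndMarginal p s.1 * sndMarginal q s.2)]
    simp only [← Finset.mul_sum, sum_sndMarginal hq, mul_one, sum_sndMarginal hp]
    have h1 := (condIndepCoupling_mem_stdSimplex hp hq.1 hpq).2
    rw [Fintype.sum_prod_type_right] at h1
    exact sub_eq_zero.2 h1
  have heq := (Finset.sum_eq_sum_iff_of_le fun s _ => hle s).1
    (le_antisymm (Finset.sum_le_sum fun s _ => hle s) (h.trans hsum.ge))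
  intro y z
  exact eq_of_sub_eq_mul_log_sub_log (ha (y, z)) (hb (y, z)) (hac (y, z))
    (heq (y, z) (Finset.mem_univ _))

theorem sharedInfo_eq_zero_iff {P : X × Y × Z → ℝ} (hP : P ∈ stdSimplex ℝ (X × Y × Z)) :
    sharedInfo P = 0 ↔ Decoupled (margXY P) (margXZ P) := by
  have hp := margXY_mem hP
  have hq := margXZ_mem hP
  have hpq := fstMarginal_margXY_eq P
  have hgr := isGreatest_sharedInfo hP
  have hmem : condIndepCoupling (margXY P) (margXZ P) ∈ DeltaP P :=
    ⟨condIndepCoupling_mem_stdSimplex hp hq.1 hpq, margXY_condIndepCoupling hp.1 hpq,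
      margXZ_condIndepCoupling hq.1 hpq⟩
  have hle := hgr.2 ⟨_, hmem, rfl⟩
  refine ⟨fun h => decoupled_of_coInfo_condIndepCoupling_nonpos hp hq hpq (h ▸ hle), fun h => ?_⟩
  refine le_antisymm ?_ (le_trans (ge_of_eq ?_) hle)
  · obtain ⟨Q, hQ, hval⟩ := hgr.1
    rw [← hval]
    refine coInfo_nonpos hQ.1 ?_
    rw [hQ.2.1, hQ.2.2]
    exact h
  · rw [coInfo_condIndepCoupling hp.1 hq.1 hpq]
    refine Finset.sum_eq_zero fun y _ => Finset.sum_eq_zero fun z _ => ?_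
    rw [← h y z]
    exact mul_eq_zero_of_right _ (sub_self _)

/-! ### Projected information -/

/-- An information projection of `p(· | y)` onto the convex hull dominates `p(· | y)`. -/
theorem eq_zero_of_infoProj_eq_zero {p : X × Y → ℝ} {q : X × Z → ℝ}
    (hp : p ∈ stdSimplex ℝ (X × Y)) (hq : q ∈ stdSimplex ℝ (X × Z))
    (hpq : fstMarginal p = fstMarginal q) {y : Y} {x : X}
    (hx : infoProj (condDist p y) (condHull q) x = 0) : condDist p y x = 0 := by
  have hi := isInfoProjection_infoProj hp hq y
  have hm : ∀ x, fstMarginal p x = 0 → condDist p y x = 0 := fun x hx => by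
    simp [condDist, eq_zero_of_fstMarginal_eq_zero hp.1 hx y]
  have hle := hi.2 _ (hpq ▸ fstMarginal_mem_condHull hq)
  rw [relEntropy, relEntropy, if_pos hm] at hle
  by_contra hne
  rw [if_neg fun h => hne (h x hx)] at hle
  exact EReal.coe_ne_top _ (top_le_iff.1 hle)

/-- The information projection of `p(· | y)` maximizes `s ↦ ∑ x, p(x,y) log (s(x) / m(x))`
over the members `s` of the convex hull that dominate the marginal `m` of `X`. -/
theorem sum_mul_log_div_le_infoProj {p : X × Y → ℝ} {q : X × Z → ℝ}
    (hp : p ∈ stdSimplex ℝ (X × Y)) (hq : q ∈ stdSimplex ℝ (X × Z))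
    (hpq : fstMarginal p = fstMarginal q) {s : X → ℝ} (hs : s ∈ condHull q)
    (hsm : ∀ x, s x = 0 → fstMarginal p x = 0) (y : Y) :
    ∑ x, p (x, y) * Real.log (s x / fstMarginal p x) ≤
      ∑ x, p (x, y) * Real.log (infoProj (condDist p y) (condHull q) x / fstMarginal p x) := by
  rcases (sndMarginal_nonneg hp y).eq_or_lt with hy | hy
  · simp [eq_zero_of_sndMarginal_eq_zero hp.1 hy.symm]
  have hm : ∀ x, fstMarginal p x = 0 → condDist p y x = 0 := fun x hx => by
    simp [condDist, eq_zero_of_fstMarginal_eq_zero hp.1 hx y]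
  have hle := (isInfoProjection_infoProj hp hq y).2 s hs
  have hr := fun x => eq_zero_of_infoProj_eq_zero hp hq hpq (y := y) (x := x)
  rw [relEntropy, relEntropy, if_pos hr, if_pos fun x hx => hm x (hsm x hx),
    EReal.coe_le_coe_iff] at hle
  have key : ∀ t : X → ℝ, (∀ x, t x = 0 → condDist p y x = 0) →
      ∑ x, p (x, y) * Real.log (t x / fstMarginal p x) = sndMarginal p y *
        (∑ x, condDist p y x * Real.log (condDist p y x / fstMarginal p x) -
          ∑ x, condDist p y x * Real.log (condDist p y x / t x)) := by
    intro t ht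
    rw [← Finset.sum_sub_distrib, Finset.mul_sum]
    refine Finset.sum_congr rfl fun x _ => ?_
    have hpx : p (x, y) = sndMarginal p y * condDist p y x := (mul_div_cancel₀ _ hy.ne').symm
    by_cases h0 : condDist p y x = 0
    · simp [hpx, h0]
    · have ht0 : t x ≠ 0 := fun h => h0 (ht x h)
      have hm0 : fstMarginal p x ≠ 0 := fun h => h0 (hm x h)
      rw [Real.log_div ht0 hm0, Real.log_div h0 hm0, Real.log_div h0 ht0, hpx]
      ring
  rw [key _ hr, key s fun x hx => hm x (hsm x hx)]
  exact mul_le_mul_of_nonneg_left (by linarith) hy.le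

/-- The summand of the projected information at `y` is nonnegative: compare the information
projection with the marginal of `X`, for which all logarithms vanish. -/
theorem sum_mul_log_infoProj_nonneg {p : X × Y → ℝ} {q : X × Z → ℝ}
    (hp : p ∈ stdSimplex ℝ (X × Y)) (hq : q ∈ stdSimplex ℝ (X × Z))
    (hpq : fstMarginal p = fstMarginal q) (y : Y) :
    0 ≤ ∑ x, p (x, y) *
      Real.log (infoProj (condDist p y) (condHull q) x / fstMarginal p x) := by
  refine le_trans (ge_of_eq (Finset.sum_eq_zero fun x _ => ?_)) (sum_mul_log_div_le_infoProj hp hq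
    hpq (hpq ▸ fstMarginal_mem_condHull hq) (fun x hx => hx) y)
  by_cases h : fstMarginal p x = 0 <;> simp [h]

theorem projectedInfo_nonneg {p : X × Y → ℝ} {q : X × Z → ℝ}
    (hp : p ∈ stdSimplex ℝ (X × Y)) (hq : q ∈ stdSimplex ℝ (X × Z))
    (hpq : fstMarginal p = fstMarginal q) : 0 ≤ projectedInfo p q :=
  Finset.sum_nonneg fun y _ => sum_mul_log_infoProj_nonneg hp hq hpq y

/-- One-sided derivative at `t = 0` of `t ↦ ∑ i, c i * log (1 + t * a i)`: if the function is
nonpositive for small `t > 0`, then so is its derivative. -/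
theorem sum_mul_nonpos_of_sum_mul_log_nonpos {α : Type*} [Fintype α] {c a : α → ℝ}
    (hc : ∀ i, 0 ≤ c i) (ha : ∀ i, -1 ≤ a i)
    (h : ∀ t : ℝ, 0 < t → t < 1 → ∑ i, c i * Real.log (1 + t * a i) ≤ 0) :
    ∑ i, c i * a i ≤ 0 := by
  have hbound : ∀ t : ℝ, 0 < t → t < 1 → ∑ i, c i * (a i / (1 + t * a i)) ≤ 0 := by
    intro t ht ht1
    -- `u / (1 + u) = 1 - (1 + u)⁻¹ ≤ log (1 + u)` with `u = t * a i`
    have hle : t * ∑ i, c i * (a i / (1 + t * a i)) ≤ ∑ i, c i * Real.log (1 + t * a i) := by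
      rw [Finset.mul_sum]
      refine Finset.sum_le_sum fun i _ => ?_
      have hpos : 0 < 1 + t * a i := by nlinarith [ha i]
      have h1 := mul_le_mul_of_nonneg_left (Real.one_sub_inv_le_log_of_pos hpos) (hc i)
      refine le_trans (le_of_eq ?_) h1
      field_simp
      ring
    nlinarith [hle.trans (h t ht ht1)]
  have hcont : Filter.Tendsto (fun t : ℝ => ∑ i, c i * (a i / (1 + t * a i)))
      (nhdsWithin 0 (Set.Ioi 0)) (nhds (∑ i, c i * a i)) := by
    refine tendsto_finsetSum _ fun i _ => ?_
    have : ContinuousAt (fun t : ℝ => c i * (a i / (1 + t * a i))) 0 := by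
      refine continuousAt_const.mul (continuousAt_const.div (by fun_prop) (by simp))
    have h2 := this.tendsto
    simp only [zero_mul, add_zero, div_one] at h2
    exact h2.mono_left nhdsWithin_le_nhds
  refine le_of_tendsto hcont ?_
  filter_upwards [Ioo_mem_nhdsGT (zero_lt_one (α := ℝ))] with t ht
  exact hbound t ht.1 ht.2

/-- The first-order condition for the marginal of `X` to be the projection of `p(· | y)`, in the
direction of `q(· | z)`. -/
theorem sum_mul_div_le_of_infoProj_nonpos {p : X × Y → ℝ} {q : X × Z → ℝ}
    (hp : p ∈ stdSimplex ℝ (X × Y)) (hq : q ∈ stdSimplex ℝ (X × Z))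
    (hpq : fstMarginal p = fstMarginal q) {y : Y}
    (h : ∑ x, p (x, y) *
      Real.log (infoProj (condDist p y) (condHull q) x / fstMarginal p x) ≤ 0) (z : Z) :
    ∑ x, p (x, y) * q (x, z) / fstMarginal p x ≤ sndMarginal p y * sndMarginal q z := by
  rcases (sndMarginal_nonneg hq z).eq_or_lt with hz | hz
  · simp [eq_zero_of_sndMarginal_eq_zero hq.1 hz.symm, ← hz]
  have hm0 := fstMarginal_nonneg hp.1
  have hr0 := condDist_nonneg hq z
  have key := sum_mul_nonpos_of_sum_mul_log_nonpos (c := fun x => p (x, y))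
    (a := fun x => condDist q z x / fstMarginal p x - 1) (fun x => hp.1 _)
    (fun x => by have := div_nonneg (hr0 x) (hm0 x); linarith) (fun t ht ht1 => by
      have hmem : (1 - t) • fstMarginal p + t • condDist q z ∈ condHull q :=
        convex_convexHull ℝ _ (hpq ▸ fstMarginal_mem_condHull hq)
          (subset_convexHull ℝ {r | ∃ z, 0 < sndMarginal q z ∧ r = condDist q z} ⟨z, hz, rfl⟩)
          (by linarith) ht.le (by ring)
      refine le_trans (Finset.sum_le_sum fun x _ => ?_) ((sum_mul_log_div_le_infoProj hp hq hpq hmem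
        (fun x hx => ?_) y).trans h)
      · by_cases hx : fstMarginal p x = 0
        · simp [eq_zero_of_fstMarginal_eq_zero hp.1 hx y]
        · refine le_of_eq ?_
          congr 2
          simp only [Pi.add_apply, Pi.smul_apply, smul_eq_mul]
          field_simp
          ring
      · simp only [Pi.add_apply, Pi.smul_apply, smul_eq_mul] at hx
        nlinarith [mul_nonneg ht.le (hr0 x), hm0 x])
  have hrw : ∑ x, p (x, y) * (condDist q z x / fstMarginal p x - 1) =
      (∑ x, p (x, y) * q (x, z) / fstMarginal p x) / sndMarginal q z - sndMarginal p y := by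
    rw [Finset.sum_div, show sndMarginal p y = ∑ x, p (x, y) from rfl, ← Finset.sum_sub_distrib]
    refine Finset.sum_congr rfl fun x _ => ?_
    rw [condDist]
    ring
  rw [hrw, sub_nonpos, div_le_iff₀ hz] at key
  exact key

/-- The total mass of the coupling over `z` is the mass of `y`. -/
theorem sum_sum_mul_div_fstMarginal {p : X × Y → ℝ} {q : X × Z → ℝ} (hp : ∀ s, 0 ≤ p s)
    (hpq : fstMarginal p = fstMarginal q) (y : Y) :
    ∑ z, ∑ x, p (x, y) * q (x, z) / fstMarginal p x = sndMarginal p y := by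
  rw [Finset.sum_comm]
  exact Finset.sum_congr rfl fun x _ =>
    congrFun (margXY_condIndepCoupling (q := q) hp hpq) (x, y)

theorem projectedInfo_eq_zero_iff {p : X × Y → ℝ} {q : X × Z → ℝ}
    (hp : p ∈ stdSimplex ℝ (X × Y)) (hq : q ∈ stdSimplex ℝ (X × Z))
    (hpq : fstMarginal p = fstMarginal q) : projectedInfo p q = 0 ↔ Decoupled p q := by
  constructor
  · intro h y
    have hy := (Finset.sum_eq_zero_iff_of_nonneg
      fun y _ => sum_mul_log_infoProj_nonneg hp hq hpq y).1 h y (Finset.mem_univ y)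
    have hle := sum_mul_div_le_of_infoProj_nonpos hp hq hpq hy.le
    have heq := (Finset.sum_eq_sum_iff_of_le (s := Finset.univ) fun z _ => hle z).1 (by
      rw [sum_sum_mul_div_fstMarginal hp.1 hpq, ← Finset.mul_sum, sum_sndMarginal hq, mul_one])
    exact fun z => heq z (Finset.mem_univ z)
  · intro h
    refine le_antisymm (Finset.sum_nonpos fun y _ => ?_) (projectedInfo_nonneg hp hq hpq)
    have hi := isInfoProjection_infoProj hp hq y
    have hr := fun x => eq_zero_of_infoProj_eq_zero hp hq hpq (y := y) (x := x)
    set r := infoProj (condDist p y) (condHull q)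
    -- the linear form below takes the value `p(y)` at each `q(· | z)`, hence on the convex hull
    have hlin : ∑ x, p (x, y) / fstMarginal p x * r x = sndMarginal p y := by
      let L : (X → ℝ) →ₗ[ℝ] ℝ := ∑ x, (p (x, y) / fstMarginal p x) • LinearMap.proj x
      have hL : ∀ s, L s = ∑ x, p (x, y) / fstMarginal p x * s x := fun s => by simp [L]
      have hsub : condHull q ⊆ L ⁻¹' {sndMarginal p y} := by
        refine convexHull_min ?_ ((convex_singleton _).linear_preimage L)
        rintro s ⟨z, hz, rfl⟩
        rw [Set.mem_preimage, Set.mem_singleton_iff, hL, eq_comm, ← mul_left_inj' hz.ne', ← h y z,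
          Finset.sum_mul]
        refine Finset.sum_congr rfl fun x _ => ?_
        rw [condDist]
        field_simp
      rw [← hL]
      exact hsub hi.1
    have hsum : ∑ x, (p (x, y) / fstMarginal p x * r x - p (x, y)) = 0 := by
      rw [Finset.sum_sub_distrib, hlin]
      exact sub_self _
    rw [← hsum]
    refine Finset.sum_le_sum fun x _ => ?_
    rcases (hp.1 (x, y)).eq_or_lt with h0 | h0
    · simp [← h0]
    have hm0 := h0.trans_le (le_fstMarginal hp.1 x y)
    have hy0 := h0.trans_le (le_sndMarginal hp.1 x y)
    have hr0 : 0 < r x := (condHull_nonneg hq r hi.1 x).lt_of_ne fun h' =>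
      (div_pos h0 hy0).ne' (hr x h'.symm)
    have h1 := mul_le_mul_of_nonneg_left (Real.log_le_sub_one_of_pos (div_pos hr0 hm0)) h0.le
    refine h1.trans (le_of_eq ?_)
    ring

end InfoDecomp

theorem mainTheorem6 {X : Type*} {Y : Type*} {Z : Type*} [Fintype X] [Fintype Y] [Fintype Z]
    (P : X × Y × Z → ℝ) (hP : P ∈ stdSimplex ℝ (X × Y × Z)) :
    InfoDecomp.redInfo P = 0 ↔ InfoDecomp.sharedInfo P = 0 := by
  open InfoDecomp in
  have hp := margXY_mem hP
  have hq := margXZ_mem hP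
  have hpq := fstMarginal_margXY_eq P
  have hY := projectedInfo_eq_zero_iff hp hq hpq
  have hZ := projectedInfo_eq_zero_iff hq hp hpq.symm
  rw [sharedInfo_eq_zero_iff hP, redInfo]
  constructor
  · intro h
    rcases min_choice (projectedInfo (margXY P) (margXZ P))
      (projectedInfo (margXZ P) (margXY P)) with h' | h'
    · exact hY.1 (h' ▸ h)
    · exact (hZ.1 (h' ▸ h)).symm hpq.symm
  · intro h
    rw [hY.2 h, hZ.2 (h.symm hpq), min_self]
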